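/- **Setting.** Fix a finite alphabet $\Sigma$ with two distinguished letters $0\neq 1$. $\mathbf{Reg}$ is the set of total functions $\varphi:\Sigma^*\to\Sigma^*$ such that $|u|\le|v|$ implies $|\varphi(u)|\le|\varphi(v)|$ and $|u|<|v|$ implies $|\varphi(u)|<|\varphi(v)|$; the size $|\varphi|:\mathbb N\to\mathbb N$ is given by $|\varphi|(|u|)=|\varphi(u)|$. Let $\langle u,v\rangle=0^{(2|u|+1)|v|}\,1\,1u_1\,1u_2\cdots 1u_{|u|}\,0\,v$, an injective pairing of strings with $|\langle u,v\rangle|=2(|u|+1)(|v|+1)$, and $\langle\psi,\varphi\rangle(u)=\langle\psi(u),\varphi(u)\rangle$. Let $\Phi_0(\varphi)(w)=w$ and $\Phi_{n+1}(\varphi)(w)=\varphi(\Phi_n(\varphi)(w))$. Second-order polynomials are generated from the positive integers and the variable $\mathtt n$ by $P+Q$, $P\cdot Q$ and $\mathtt L(P)$; $P(L)(n)$ is the value for $\mathtt L=L:\mathbb N\to\mathbb N$, $\mathtt n=n$. Degree and type ($\mathbf a$ or $\mathbf m$) are defined simultaneously. Positive integers and $\mathtt n$ have degree $0$ and type $\mathbf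 m$; $\mathtt L(P)$ has degree $\deg P+1$ and type $\mathbf a$; $P+Q$ has degree $\max\{\deg P,\deg Q\}$; $P\cdot Q$ has type $\mathbf m$. If one of $P,Q$ has type $\mathbf a$ and degree $\max\{\deg P,\deg Q\}$, then $P+Q$ has type $\mathbf a$ and $P\cdot Q$ has degree $\max\{\deg P,\deg Q\}+1$; otherwise $P+Q$ has type $\mathbf m$ and $P\cdot Q$ has degree $\max\{\deg P,\deg Q\}$. Machines are deterministic oracle Turing machines with a read-only input tape, finitely many work tapes, a write-only query tape, a read-only answer tape and a write-only output tape. A step writes at most one letter on the query tape and at most one on the output tape; an oracle call is one step, replaces the content of the answer tape by the oracle's answer and erases the query tape. A machine runs in time $P$ if on every oracle $\varphi\in\mathbf{Reg}$ and input $u\in\Sigma^*$ it halts within $P(|\varphi|)(|u|)$ steps. It computes $F:\subseteq\mathbf{Reg}\to\mathbf{Reg}$ if for all $\varphi\in\operatorname{dom}F$ and $u$ it outputs $F(\varphi)(u)$ on oracle $\varphi$ and input $u$; for $F:\subseteq\mathbf{Reg}\times\mathbf{Reg}\to\mathbf{Reg}$ the oracle is $\langle\psi,\varphi\rangle$. $P$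 witnesses polynomial-time computability of $F$ if some machine computes $F$ and runs in time $P$; $F$ is polynomial-time computable if such a $P$ exists. A $\mathbf{Reg}$-represented space is a set $X$ with a surjective partial function $\delta_X:\subseteq\mathbf{Reg}\to X$. A map $f:X\to Y$ is polynomial-time computable if there is a polynomial-time computable $F:\subseteq\mathbf{Reg}\to\mathbf{Reg}$ with $\delta_Y(F(\varphi))=f(\delta_X(\varphi))$ for all $\varphi\in\operatorname{dom}\delta_X$. $\mathbf{Reg}$ itself is represented by the identity, and $X\times Y$ by $\langle\varphi,\psi\rangle\mapsto(\delta_X(\varphi),\delta_Y(\psi))$. **Theorem.** Let the second-order polynomial $P$ witness polynomial-time computability of $F:\subseteq\mathbf{Reg}\times\mathbf{Reg}\to\mathbf{Reg}$. Then there is no $\psi\in\mathbf{Reg}$ with $F(\psi,\varphi)=\Phi_{\deg(P)+1}(\varphi)$ for all $\varphi\in\mathbf{Reg}$. **Corollary.** In the category of $\mathbf{Reg}$-represented spaces and polynomial-time computable maps there is no exponential of $\mathbf{Reg}$ by $\mathbf{Reg}$. That is, there are no represented space $E$ and polynomial-time computable $\mathrm{ev}:E\times\mathbf{Reg}\to\mathbf{Reg}$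 such that for every represented space $Z$ and every polynomial-time computable $f:Z\times\mathbf{Reg}\to\mathbf{Reg}$ there is exactly one polynomial-time computable $g:Z\to E$ with $\mathrm{ev}(g(z),x)=f(z,x)$ for all $z,x$. The same holds if arbitrary categorical products are used in place of the standard products $E\times\mathbf{Reg}$ and $Z\times\mathbf{Reg}$. Consequently the category is not cartesian closed. -/

import Mathlib

namespace PolyRep

/-- An alphabet: a finite set of letters, with two distinct letters singled out
(they serve as markers in the pairing function on strings). -/
class Alphabet (A : Type) where
  finite : Finite A
  zero : A
  one : A
  zero_ne_one : zero ≠ one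

/-! ### Regular functions -/

/-- The regular functions `φ : Σ* → Σ*` with strictly monotone size. -/
@[ext]
structure Reg (A : Type) where
  toFun : List A → List A
  regular : ∀ u v : List A, u.length ≤ v.length → (toFun u).length ≤ (toFun v).length
  strict : ∀ u v : List A, u.length < v.length → (toFun u).length < (toFun v).length

namespace Reg

instance {A : Type} : CoeFun (Reg A) (fun _ => List A → List A) := ⟨Reg.toFun⟩

/-- The size `|φ| : ℕ → ℕ`, determined by `|φ|(|u|) = |φ(u)|`, see `Reg.size_length`. -/
def size {A : Type} [Alphabet A] (φ : Reg A) (n : ℕ) : ℕ :=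
  (φ (List.replicate n Alphabet.zero)).length

theorem size_length {A : Type} [Alphabet A] (φ : Reg A) (u : List A) :
    φ.size u.length = (φ u).length :=
  le_antisymm (φ.regular _ _ (by simp)) (φ.regular _ _ (by simp))

/-- The iterates: `Φ₀(φ)(w) = w` and `Φₙ₊₁(φ)(w) = φ(Φₙ(φ)(w))`. -/
def iter {A : Type} : ℕ → Reg A → Reg A
  | 0, _ => ⟨fun w => w, fun _ _ h => h, fun _ _ h => h⟩
  | n + 1, φ =>
    ⟨fun w => φ (iter n φ w),
      fun u v h => φ.regular _ _ ((iter n φ).regular u v h),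
      fun u v h => φ.strict _ _ ((iter n φ).strict u v h)⟩

end Reg

/-! ### Pairing -/

section Pairing

variable {A : Type} [Alphabet A]

/-- `1 u₁ 1 u₂ … 1 uₖ 0 v` -/
def markStr : List A → List A → List A
  | [], v => Alphabet.zero :: v
  | x :: u, v => Alphabet.one :: x :: markStr u v

/-- The pairing `⟨u, v⟩ = 0…0 1 1 u₁ 1 u₂ … 1 uₖ 0 v`, with padding zeros in front such that
`|⟨u, v⟩| = 2 (|u| + 1) (|v| + 1)`. -/
def pairStr (u v : List A) : List A :=
  List.replicate ((2 * u.length + 1) * v.length) Alphabet.zero ++ Alphabet.one :: markStr u v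

theorem markStr_length (u v : List A) :
    (markStr u v).length = 2 * u.length + v.length + 1 := by
  induction u with
  | nil => simp [markStr]
  | cons x u ih => simp only [markStr, List.length_cons, ih]; ring

theorem pairStr_length (u v : List A) :
    (pairStr u v).length = 2 * (u.length + 1) * (v.length + 1) := by
  simp only [pairStr, List.length_append, List.length_replicate, List.length_cons, markStr_length]
  ring

theorem markStr_injective : ∀ (u v u' v' : List A),
    markStr u v = markStr u' v' → u = u' ∧ v = v'
  | [], v, [], v', h => by simpa [markStr] using h
  | [], v, x :: u', v', h => by
    simp only [markStr, List.cons.injEq] at h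
    exact absurd h.1 Alphabet.zero_ne_one
  | x :: u, v, [], v', h => by
    simp only [markStr, List.cons.injEq] at h
    exact absurd h.1.symm Alphabet.zero_ne_one
  | x :: u, v, x' :: u', v', h => by
    simp only [markStr, List.cons.injEq, true_and] at h
    obtain ⟨h1, h2⟩ := markStr_injective u v u' v' h.2
    exact ⟨by rw [h.1, h1], h2⟩

theorem padded_injective : ∀ (m m' : ℕ) (s s' : List A),
    List.replicate m (Alphabet.zero : A) ++ Alphabet.one :: s =
      List.replicate m' (Alphabet.zero : A) ++ Alphabet.one :: s' → s = s'
  | 0, 0, s, s', h => by simpa using h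
  | 0, m' + 1, s, s', h => by
    simp only [List.replicate_succ, List.replicate_zero, List.nil_append, List.cons_append,
      List.cons.injEq] at h
    exact absurd h.1.symm Alphabet.zero_ne_one
  | m + 1, 0, s, s', h => by
    simp only [List.replicate_succ, List.replicate_zero, List.nil_append, List.cons_append,
      List.cons.injEq] at h
    exact absurd h.1 Alphabet.zero_ne_one
  | m + 1, m' + 1, s, s', h => by
    simp only [List.replicate_succ, List.cons_append, List.cons.injEq, true_and] at h
    exact padded_injective m m' s s' h

theorem pairStr_injective (u v u' v' : List A) (h : pairStr u v = pairStr u' v') :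
    u = u' ∧ v = v' :=
  markStr_injective u v u' v' (padded_injective _ _ _ _ h)

/-- The pairing `⟨ψ, φ⟩(u) = ⟨ψ(u), φ(u)⟩` of regular functions. -/
def Reg.pair (ψ φ : Reg A) : Reg A where
  toFun u := pairStr (ψ u) (φ u)
  regular u v h := by
    have h1 := ψ.regular u v h
    have h2 := φ.regular u v h
    simp only [pairStr_length]
    gcongr
  strict u v h := by
    have h1 := ψ.strict u v h
    have h2 := φ.strict u v h
    simp only [pairStr_length]
    gcongr

theorem Reg.pair_injective (ψ φ ψ' φ' : Reg A) (h : Reg.pair ψ φ = Reg.pair ψ' φ') :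
    ψ = ψ' ∧ φ = φ' := by
  have key : ∀ u, ψ u = ψ' u ∧ φ u = φ' u := fun u =>
    pairStr_injective _ _ _ _ (congrFun (congrArg Reg.toFun h) u)
  exact ⟨Reg.ext (funext fun u => (key u).1), Reg.ext (funext fun u => (key u).2)⟩

end Pairing

/-! ### Second-order polynomials -/

/-- Second-order polynomials in a type-1 variable `L` and a type-0 variable `n`. -/
inductive SOPoly where
  | const (c : ℕ+) : SOPoly
  | var : SOPoly
  | add (P Q : SOPoly) : SOPoly
  | mul (P Q : SOPoly) : SOPoly
  | app (P : SOPoly) : SOPoly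

namespace SOPoly

/-- The value `P(L)(n)`. -/
def eval (L : ℕ → ℕ) (n : ℕ) : SOPoly → ℕ
  | const c => c
  | var => n
  | add P Q => eval L n P + eval L n Q
  | mul P Q => eval L n P * eval L n Q
  | app P => L (eval L n P)

/-- The two types of second-order polynomials used in the definition of the degree. -/
inductive Ty where
  | a
  | m
  deriving DecidableEq

/-- Some summand or factor of maximal degree (given with its degree and type) has type `a`. -/
def TopIsA (x y : ℕ × Ty) : Prop :=
  (x.2 = Ty.a ∧ x.1 = max x.1 y.1) ∨ (y.2 = Ty.a ∧ y.1 = max x.1 y.1)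

instance (x y : ℕ × Ty) : Decidable (TopIsA x y) := by
  unfold TopIsA; infer_instance

/-- Second-order degree and type, by simultaneous recursion. -/
def degTy : SOPoly → ℕ × Ty
  | const _ => (0, Ty.m)
  | var => (0, Ty.m)
  | add P Q =>
    (max (degTy P).1 (degTy Q).1, if TopIsA (degTy P) (degTy Q) then Ty.a else Ty.m)
  | mul P Q =>
    (if TopIsA (degTy P) (degTy Q) then max (degTy P).1 (degTy Q).1 + 1
      else max (degTy P).1 (degTy Q).1, Ty.m)
  | app P => ((degTy P).1 + 1, Ty.a)

/-- The second-order degree. -/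
def deg (P : SOPoly) : ℕ := (degTy P).1

end SOPoly

/-! ### Oracle Turing machines -/

/-- What a machine with states `Q`, work alphabet `G` and `k` work tapes does in one step.
A head movement is `none` (stay) or a direction. -/
inductive Action (A Q G : Type) (k : ℕ) where
  /-- Stop. -/
  | halt : Action A Q G k
  /-- Submit the content of the query tape to the oracle and go to state `q`. -/
  | query (q : Q) : Action A Q G k
  /-- Go to state `q`, move the heads on the input and answer tapes, write to and move on the work
  tapes, and append at most one letter to each of the query and output tapes. -/
  | step (q : Q) (inputMove answerMove : Option Turing.Dir)
      (work : Fin k → G × Option Turing.Dir) (toQuery toOutput : Option A) : Action A Q G k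

/-- A deterministic oracle Turing machine with a read-only two-way input tape, finitely many
work tapes over a finite work alphabet (the blank is `default`), a write-only query tape,
a read-only two-way answer tape, and a write-only output tape.
On the input and answer tapes the blank is `none`. -/
structure OracleTM (A : Type) where
  Q : Type
  finiteQ : Finite Q
  start : Q
  G : Type
  finiteG : Finite G
  blank : Inhabited G
  k : ℕ
  trans : Q → Option A → Option A → (Fin k → G) → Action A Q G k

namespace OracleTM

variable {A : Type}

instance (M : OracleTM A) : Inhabited M.G := M.blank

/-- Configurations. -/
structure Cfg (M : OracleTM A) where
  state : M.Q
  input : Turing.Tape (Option A)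
  work : Fin M.k → Turing.Tape M.G
  query : List A
  answer : Turing.Tape (Option A)
  output : List A

/-- A tape with the string `u` written on it, the head on the first letter. -/
def stringTape (u : List A) : Turing.Tape (Option A) := Turing.Tape.mk₁ (u.map some)

/-- Moving the head (or staying). -/
def moveHead {G : Type} [Inhabited G] (T : Turing.Tape G) : Option Turing.Dir → Turing.Tape G
  | none => T
  | some d => T.move d

/-- The initial configuration on input `u`. -/
def init (M : OracleTM A) (u : List A) : M.Cfg where
  state := M.start
  input := stringTape u
  work := fun _ => Turing.Tape.mk₁ []
  query := []
  answer := stringTape []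
  output := []

/-- The action that the machine takes in a configuration. -/
def action (M : OracleTM A) (c : M.Cfg) : Action A M.Q M.G M.k :=
  M.trans c.state c.input.head c.answer.head (fun i => (c.work i).head)

/-- The configuration is halted. -/
def Halted (M : OracleTM A) (c : M.Cfg) : Prop := M.action c = Action.halt

/-- One step with oracle `φ`; a halted configuration does not change. A query is one step: it
replaces the content of the answer tape by the answer, with the head on its first letter, and
erases the query tape. -/
def next (M : OracleTM A) (φ : List A → List A) (c : M.Cfg) : M.Cfg :=
  match M.action c with
  | Action.halt => c
  | Action.query q => { c with state := q, query := [], answer := stringTape (φ c.query) }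
  | Action.step q inputMove answerMove work toQuery toOutput =>
    { state := q
      input := moveHead c.input inputMove
      work := fun i => moveHead ((c.work i).write (work i).1) (work i).2
      query := c.query ++ toQuery.toList
      answer := moveHead c.answer answerMove
      output := c.output ++ toOutput.toList }

/-- The configuration after `t` steps with oracle `φ` on input `u`. -/
def run (M : OracleTM A) (φ : List A → List A) (u : List A) (t : ℕ) : M.Cfg :=
  (M.next φ)^[t] (M.init u)

/-- On oracle `φ` and input `u` the machine outputs `v` and halts. -/
def Outputs (M : OracleTM A) (φ : List A → List A) (u v : List A) : Prop :=
  ∃ t, M.Halted (M.run φ u t) ∧ (M.run φ u t).output = v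

/-- `M` computes the partial function `F`. -/
def Computes (M : OracleTM A) (F : Reg A →. Reg A) : Prop :=
  ∀ φ : Reg A, ∀ χ ∈ F φ, ∀ u, M.Outputs φ u (χ u)

/-- `M` computes the partial function `F` of two arguments, i.e. it outputs `F(ψ, φ)(u)` on oracle
`⟨ψ, φ⟩` and input `u`. -/
def Computes₂ [Alphabet A] (M : OracleTM A) (F : Reg A × Reg A →. Reg A) : Prop :=
  ∀ ψ φ : Reg A, ∀ χ ∈ F (ψ, φ), ∀ u, M.Outputs (Reg.pair ψ φ) u (χ u)

/-- `M` runs in time `P`: for all regular oracles `φ` and inputs `u` it halts within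
`P(|φ|)(|u|)` steps. -/
def RunsInTime [Alphabet A] (M : OracleTM A) (P : SOPoly) : Prop :=
  ∀ (φ : Reg A) (u : List A), M.Halted (M.run φ u (P.eval φ.size u.length))

end OracleTM

/-- `F` is computable in polynomial time. -/
def PolyTimeComputable {A : Type} [Alphabet A] (F : Reg A →. Reg A) : Prop :=
  ∃ (M : OracleTM A) (P : SOPoly), M.Computes F ∧ M.RunsInTime P

/-- The second-order polynomial `P` witnesses that `F` is computable in polynomial time. -/
def WitnessesPolyTime₂ {A : Type} [Alphabet A] (P : SOPoly) (F : Reg A × Reg A →. Reg A) : Prop :=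
  ∃ M : OracleTM A, M.Computes₂ F ∧ M.RunsInTime P

/-! ### Represented spaces -/

/-- A represented space: a set with a surjective partial function from `Reg` onto it. (Any set
with such a surjection is in bijection with one in `Type`.) -/
structure RepSpace (A : Type) where
  carrier : Type
  rep : Reg A →. carrier
  surj : ∀ x : carrier, ∃ φ : Reg A, x ∈ rep φ

namespace RepSpace

variable {A : Type}

instance : CoeSort (RepSpace A) Type := ⟨RepSpace.carrier⟩

/-- `F` is a realizer of `f`: `δ_Y(F(φ)) = f(δ_X(φ))` for all `φ ∈ dom δ_X`. -/
def Realizes {X Y : RepSpace A} (F : Reg A →. Reg A) (f : X → Y) : Prop :=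
  ∀ (φ : Reg A) (x : X), x ∈ X.rep φ → ∃ χ ∈ F φ, f x ∈ Y.rep χ

/-- `f` is polynomial-time computable, i.e. a morphism of the category of represented spaces and
polynomial-time computable maps. -/
def IsPolyTime [Alphabet A] {X Y : RepSpace A} (f : X → Y) : Prop :=
  ∃ F : Reg A →. Reg A, PolyTimeComputable F ∧ Realizes F f

/-- The space `Reg`, represented by the identity. -/
def reg (A : Type) : RepSpace A where
  carrier := Reg A
  rep := PFun.id (Reg A)
  surj φ := ⟨φ, Part.mem_some φ⟩

/-- The standard product: `⟨φ, ψ⟩` is a name of `(x, y)` iff `φ` is a name of `x` and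
`ψ` is a name of `y`. See `mem_prodRep`. -/
noncomputable def prodRep [Alphabet A] (X Y : RepSpace A) : Reg A →. X × Y := fun χ =>
  ⟨∃ (z : X × Y) (φ ψ : Reg A), χ = Reg.pair φ ψ ∧ z.1 ∈ X.rep φ ∧ z.2 ∈ Y.rep ψ,
    fun h => h.choose⟩

theorem mem_prodRep [Alphabet A] (X Y : RepSpace A) (χ : Reg A) (z : X × Y) :
    z ∈ prodRep X Y χ ↔
      ∃ φ ψ : Reg A, χ = Reg.pair φ ψ ∧ z.1 ∈ X.rep φ ∧ z.2 ∈ Y.rep ψ := by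
  constructor
  · rintro ⟨h, rfl⟩
    exact h.choose_spec
  · rintro ⟨φ, ψ, hχ, h1, h2⟩
    have h : (prodRep X Y χ).Dom := ⟨z, φ, ψ, hχ, h1, h2⟩
    refine ⟨h, ?_⟩
    obtain ⟨φ', ψ', hχ', h1', h2'⟩ := h.choose_spec
    obtain ⟨rfl, rfl⟩ := Reg.pair_injective _ _ _ _ (hχ.symm.trans hχ')
    exact Prod.ext (Part.mem_unique h1' h1) (Part.mem_unique h2' h2)

/-- The product `X × Y` of represented spaces. -/
noncomputable def prod [Alphabet A] (X Y : RepSpace A) : RepSpace A where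
  carrier := X × Y
  rep := prodRep X Y
  surj z := by
    obtain ⟨φ, hφ⟩ := X.surj z.1
    obtain ⟨ψ, hψ⟩ := Y.surj z.2
    exact ⟨Reg.pair φ ψ, (mem_prodRep X Y _ z).2 ⟨φ, ψ, rfl, hφ, hψ⟩⟩

/-- `E` with evaluation `ev : E × X → Y` is an exponential of `Y` by `X`, with respect to the
standard products of represented spaces. -/
def IsExponential [Alphabet A] (X Y E : RepSpace A) (ev : E.prod X → Y) : Prop :=
  IsPolyTime ev ∧
    ∀ (Z : RepSpace A) (f : Z.prod X → Y), IsPolyTime f →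
      ∃! g : Z → E, IsPolyTime g ∧ ∀ (z : Z) (x : X), ev (g z, x) = f (z, x)

/-! The categorical notions, spelled out in the category of represented spaces and
polynomial-time computable maps. -/

/-- `T` is a terminal object. -/
def IsTerminal [Alphabet A] (T : RepSpace A) : Prop :=
  ∀ Z : RepSpace A, ∃! h : Z → T, IsPolyTime h

/-- `W` with projections `p`, `q` is a categorical product of `X` and `Y`. -/
def IsProduct [Alphabet A] (X Y W : RepSpace A) (p : W → X) (q : W → Y) : Prop :=
  IsPolyTime p ∧ IsPolyTime q ∧
    ∀ (Z : RepSpace A) (f : Z → X) (g : Z → Y), IsPolyTime f → IsPolyTime g →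
      ∃! h : Z → W, IsPolyTime h ∧ p ∘ h = f ∧ q ∘ h = g

/-- `Y` has an exponential by `X` in the categorical sense: an object `E`, a product `W` of `E` and
`X`, and a morphism `ev : W → Y` such that for every product `V` of an object `Z` with `X`, each
morphism `f : V → Y` is `ev ∘ (g × id)` for a unique morphism `g : Z → E`. Here `h` is `g × id`. -/
def HasExponential [Alphabet A] (X Y : RepSpace A) : Prop :=
  ∃ (E W : RepSpace A) (p : W → E) (q : W → X) (ev : W → Y),
    IsProduct E X W p q ∧ IsPolyTime ev ∧
      ∀ (Z V : RepSpace A) (r : V → Z) (s : V → X), IsProduct Z X V r s →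
        ∀ f : V → Y, IsPolyTime f →
          ∃! g : Z → E, IsPolyTime g ∧
            ∃ h : V → W, IsPolyTime h ∧ p ∘ h = g ∘ r ∧ q ∘ h = s ∧ ev ∘ h = f

/-- The category of represented spaces over the alphabet `A` and polynomial-time computable maps is
cartesian closed. -/
def IsCartesianClosed (A : Type) [Alphabet A] : Prop :=
  (∃ T : RepSpace A, IsTerminal T) ∧
    (∀ X Y : RepSpace A, ∃ (W : RepSpace A) (p : W → X) (q : W → Y), IsProduct X Y W p q) ∧
      ∀ X Y : RepSpace A, HasExponential X Y

end RepSpace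

end PolyRep

namespace PolyRep

/-! ### Growth of second-order polynomials -/

namespace SOPoly

/-! A machine writes at most one output letter per step, so `P` bounds the length of F(ψ, φ)(u) by
P(|⟨ψ, φ⟩|)(|u|). For fixed ψ, let g be `fastGrowing ψ.size` and let φ have size g. The two summands
in the recursion for g ensure |⟨ψ, φ⟩|(n) ≤ g(n+1) and g(n)² ≤ g(n+1). Sums and products are thus
absorbed into a slightly larger argument, and only `app` costs a new application of g. With d = deg
P this yields P(|⟨ψ, φ⟩|)(n) ≤ g^d((n+2)^(c+1)) (`SOPoly.exists_eval_le`). Since g is at least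
doubly exponential, some n has (n+2)^(c+1) < g(n), and then the bound lies below g^(d+1)(n), the
length of the (d+1)-fold iterate of φ on a string of length n (`Reg.exists_eval_lt_length_iter`).

An exponential would contradict this. If `ev` runs in time P, iteration deg P + 1 times is still a
morphism, so it is the section of `ev` at some point, and a name of that point serves as ψ. For an
arbitrary product W of E and Reg, the comparison map from the standard product to W costs some time
R, and P is replaced by `comp R P`. The morphisms needed are realized by iterating an oracle
followed by a finite transducer, so no general composition of machines is required. -/

theorem eval_mono {L L' : ℕ → ℕ} (hL : ∀ m, L m ≤ L' m) (hL' : Monotone L') {n n' : ℕ}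
    (hn : n ≤ n') (P : SOPoly) : P.eval L n ≤ P.eval L' n' := by
  induction P with
  | const c => exact le_rfl
  | var => exact hn
  | add P Q hP hQ => exact add_le_add hP hQ
  | mul P Q hP hQ => exact Nat.mul_le_mul hP hQ
  | app P hP => exact (hL _).trans (hL' hP)

/-- Substitution of `X` for the type-0 variable. -/
def subst (X : SOPoly) : SOPoly → SOPoly
  | const c => const c
  | var => X
  | add P Q => add (subst X P) (subst X Q)
  | mul P Q => mul (subst X P) (subst X Q)
  | app P => app (subst X P)

theorem eval_subst (L : ℕ → ℕ) (n : ℕ) (X P : SOPoly) :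
    (subst X P).eval L n = P.eval L (X.eval L n) := by
  induction P with
  | const c => rfl
  | var => rfl
  | add P Q hP hQ => simp only [subst, eval, hP, hQ]
  | mul P Q hP hQ => simp only [subst, eval, hP, hQ]
  | app P hP => simp only [subst, eval, hP]

/-- Substitution of `R` for the type-1 variable. -/
def comp (R : SOPoly) : SOPoly → SOPoly
  | const c => const c
  | var => var
  | add P Q => add (comp R P) (comp R Q)
  | mul P Q => mul (comp R P) (comp R Q)
  | app P => subst (comp R P) R

theorem eval_comp (L : ℕ → ℕ) (n : ℕ) (R P : SOPoly) :
    (comp R P).eval L n = P.eval (fun m => R.eval L m) n := by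
  induction P with
  | const c => rfl
  | var => rfl
  | add P Q hP hQ => simp only [comp, eval, hP, hQ]
  | mul P Q hP hQ => simp only [comp, eval, hP, hQ]
  | app P hP => simp only [comp, eval, eval_subst, hP]

theorem deg_app (P : SOPoly) : (app P).deg = P.deg + 1 := rfl

/-- The growth bound uses nothing else about types: the extra degree that a product may receive only
weakens it. -/
theorem max_deg_le_deg_mul (P Q : SOPoly) : max P.deg Q.deg ≤ (mul P Q).deg := by
  change _ ≤ ite _ _ _
  split_ifs
  · exact Nat.le_succ _
  · exact le_rfl

end SOPoly

/-- A function growing fast enough to dominate both its own square and the size of its pairing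
with a function of size `f`. -/
def fastGrowing (f : ℕ → ℕ) : ℕ → ℕ
  | 0 => 2
  | n + 1 => 2 * (f n + 1) * (fastGrowing f n + 1) + fastGrowing f n * fastGrowing f n

section FastGrowing

variable (f : ℕ → ℕ)

theorem two_le_fastGrowing (n : ℕ) : 2 ≤ fastGrowing f n := by
  induction n with
  | zero => exact le_rfl
  | succ n ih => rw [fastGrowing]; nlinarith

theorem fastGrowing_mul_self_le (n : ℕ) :
    fastGrowing f n * fastGrowing f n ≤ fastGrowing f (n + 1) :=
  Nat.le_add_left _ _

theorem strictMono_fastGrowing : StrictMono (fastGrowing f) := by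
  refine strictMono_nat_of_lt_succ fun n => ?_
  have := two_le_fastGrowing f n
  have := fastGrowing_mul_self_le f n
  nlinarith

theorem two_pow_two_pow_le_fastGrowing (n : ℕ) : 2 ^ 2 ^ n ≤ fastGrowing f n := by
  induction n with
  | zero => exact le_rfl
  | succ n ih =>
    refine le_trans ?_ (fastGrowing_mul_self_le f n)
    rw [pow_succ 2 n, pow_mul, sq]
    exact Nat.mul_le_mul ih ih

/-- A double exponential beats every power: (m+2)^c ≤ 2^(c(m+2)) < 2^(2^m). -/
theorem exists_pow_lt_fastGrowing (c : ℕ) : ∃ n, (n + 2) ^ c < fastGrowing f n := by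
  obtain ⟨m, hm⟩ : ∃ m : ℕ, c * (m + 2) < 2 ^ m := by
    refine ⟨2 * c + 4, ?_⟩
    have := Nat.lt_two_pow_self (n := c)
    rw [pow_add, pow_mul', sq]
    nlinarith
  refine ⟨m, lt_of_lt_of_le ?_ (two_pow_two_pow_le_fastGrowing f m)⟩
  have h1 : (m + 2) ^ c ≤ (2 ^ (m + 2)) ^ c := Nat.pow_le_pow_left Nat.lt_two_pow_self.le _
  rw [← pow_mul] at h1
  exact h1.trans_lt (Nat.pow_lt_pow_right (by norm_num) (by linarith [mul_comm c (m + 2)]))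

theorem two_le_iterate_fastGrowing (d : ℕ) {x : ℕ} (hx : 2 ≤ x) :
    2 ≤ (fastGrowing f)^[d] x := by
  cases d with
  | zero => exact hx
  | succ d => rw [Function.iterate_succ_apply']; exact two_le_fastGrowing f _

/-- The outermost g turns the square into +1 on its argument; strict monotonicity of the inner
iterates moves that +1 down to x. -/
theorem iterate_fastGrowing_mul_self_le (d : ℕ) (x : ℕ) :
    (fastGrowing f)^[d + 1] x * (fastGrowing f)^[d + 1] x ≤ (fastGrowing f)^[d + 1] (x + 1) := by
  rw [Function.iterate_succ_apply', Function.iterate_succ_apply']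
  exact (fastGrowing_mul_self_le f _).trans ((strictMono_fastGrowing f).monotone
    (((strictMono_fastGrowing f).iterate d) (Nat.lt_succ_self x)))

theorem iterate_fastGrowing_le {d d' x x' : ℕ} (hd : d ≤ d') (hx : x ≤ x') :
    (fastGrowing f)^[d] x ≤ (fastGrowing f)^[d'] x' :=
  (((strictMono_fastGrowing f).iterate d).monotone hx).trans
    (Function.monotone_iterate_of_id_le (strictMono_fastGrowing f).id_le hd x')

/-- For d = 0 squaring doubles the exponent exactly; for d > 0 any strict increase of the argument
suffices. -/
theorem iterate_fastGrowing_pow_mul_le (d c n : ℕ) :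
    (fastGrowing f)^[d] ((n + 2) ^ (c + 1)) * (fastGrowing f)^[d] ((n + 2) ^ (c + 1)) ≤
      (fastGrowing f)^[d] ((n + 2) ^ (2 * c + 2)) := by
  cases d with
  | zero => simp only [Function.iterate_zero, id, ← pow_add]; exact le_of_eq (by ring)
  | succ d =>
    refine (iterate_fastGrowing_mul_self_le f d _).trans (iterate_fastGrowing_le f le_rfl ?_)
    exact Nat.succ_le_of_lt (Nat.pow_lt_pow_right (by omega) (by omega))

/-- A second-order polynomial of degree `d`, applied to a function dominated by a shift of the
fast growing function `g`, is bounded by `g^d` of an ordinary polynomial. -/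
theorem SOPoly.exists_eval_le {L : ℕ → ℕ} (hL : ∀ n, L n ≤ fastGrowing f (n + 1)) (P : SOPoly) :
    ∃ c, ∀ n, P.eval L n ≤ (fastGrowing f)^[P.deg] ((n + 2) ^ (c + 1)) := by
  induction P with
  | const c =>
    refine ⟨c, fun n => ?_⟩
    calc (c : ℕ) ≤ 2 ^ (c : ℕ) := Nat.lt_two_pow_self.le
      _ ≤ (n + 2) ^ (c : ℕ) := Nat.pow_le_pow_left (by omega) _
      _ ≤ (n + 2) ^ ((c : ℕ) + 1) := Nat.pow_le_pow_right (by omega) (by omega)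
  | var => exact ⟨0, fun n => by change n ≤ (n + 2) ^ (0 + 1); simp⟩
  | add P Q hP hQ =>
    obtain ⟨a, ha⟩ := hP
    obtain ⟨b, hb⟩ := hQ
    refine ⟨2 * max a b + 1, fun n => ?_⟩
    set X := (fastGrowing f)^[max P.deg Q.deg] ((n + 2) ^ (max a b + 1)) with hX
    have h2 : 2 ≤ X := two_le_iterate_fastGrowing f _
      (le_trans (by omega) (Nat.le_self_pow (Nat.succ_ne_zero _) (n + 2)))
    have h1 : P.eval L n ≤ X := (ha n).trans (iterate_fastGrowing_le f (le_max_left _ _)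
      (Nat.pow_le_pow_right (by omega) (by omega)))
    have h3 : Q.eval L n ≤ X := (hb n).trans (iterate_fastGrowing_le f (le_max_right _ _)
      (Nat.pow_le_pow_right (by omega) (by omega)))
    -- As X ≥ 2, X + X ≤ X * X, so sums reduce to the case of products.
    calc P.eval L n + Q.eval L n ≤ X * X := by nlinarith
      _ ≤ _ := iterate_fastGrowing_pow_mul_le f _ _ n
  | mul P Q hP hQ =>
    obtain ⟨a, ha⟩ := hP
    obtain ⟨b, hb⟩ := hQ
    refine ⟨2 * max a b + 1, fun n => ?_⟩
    have h1 := (ha n).trans (iterate_fastGrowing_le f (le_max_left P.deg Q.deg)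
      (Nat.pow_le_pow_right (by omega) (show a + 1 ≤ max a b + 1 by omega)))
    have h3 := (hb n).trans (iterate_fastGrowing_le f (le_max_right P.deg Q.deg)
      (Nat.pow_le_pow_right (by omega) (show b + 1 ≤ max a b + 1 by omega)))
    calc P.eval L n * Q.eval L n ≤ _ := Nat.mul_le_mul h1 h3
      _ ≤ _ := iterate_fastGrowing_pow_mul_le f _ _ n
      _ ≤ _ := iterate_fastGrowing_le f (max_deg_le_deg_mul P Q) le_rfl
  | app P hP =>
    obtain ⟨a, ha⟩ := hP
    -- The larger exponent makes the argument strictly larger, which pays for the shift n + 1 in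
    -- `hL`.
    refine ⟨a + 1, fun n => ?_⟩
    rw [deg_app, Function.iterate_succ_apply']
    refine (hL _).trans ((strictMono_fastGrowing f).monotone (Nat.succ_le_of_lt ?_))
    exact (ha n).trans_lt (((strictMono_fastGrowing f).iterate _)
      (Nat.pow_lt_pow_right (by omega) (by omega)))

end FastGrowing

/-! ### Iterates outgrow second-order polynomials of lower degree -/

namespace Reg

variable {A : Type}

theorem iter_apply (n : ℕ) (φ : Reg A) (u : List A) : iter n φ u = φ.toFun^[n] u := by
  induction n with
  | zero => rfl
  | succ n ih => rw [Function.iterate_succ_apply', ← ih]; rfl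

variable [Alphabet A]

theorem monotone_size (φ : Reg A) : Monotone φ.size := fun m n h =>
  φ.regular _ _ (by simpa using h)

/-- The regular function of size `f` whose values consist of zeros. -/
def ofSize (f : ℕ → ℕ) (hf : StrictMono f) : Reg A where
  toFun u := List.replicate (f u.length) Alphabet.zero
  regular u v h := by simpa using hf.monotone h
  strict u v h := by simpa using hf h

theorem length_ofSize_iterate (f : ℕ → ℕ) (hf : StrictMono f) (n : ℕ) (u : List A) :
    ((ofSize f hf).toFun^[n] u).length = f^[n] u.length := by
  induction n with
  | zero => rfl
  | succ n ih => simp [Function.iterate_succ_apply', ← ih, ofSize]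

theorem size_pair (ψ φ : Reg A) (n : ℕ) :
    (pair ψ φ).size n = 2 * (ψ.size n + 1) * (φ.size n + 1) :=
  pairStr_length _ _

/-- For fixed `ψ`, no second-order polynomial `P` in the size of `⟨ψ, φ⟩` bounds the length of the
`(deg P + 1)`-fold iterate of `φ`. -/
theorem exists_eval_lt_length_iter (P : SOPoly) (ψ : Reg A) :
    ∃ (φ : Reg A) (u : List A),
      P.eval (pair ψ φ).size u.length < (iter (P.deg + 1) φ u).length := by
  have hg := strictMono_fastGrowing ψ.size
  obtain ⟨c, hc⟩ := P.exists_eval_le (f := ψ.size) (L := (pair ψ (ofSize _ hg)).size) fun n => by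
    rw [size_pair]
    have : (ofSize _ hg : Reg A).size n = fastGrowing ψ.size n := by simp [size, ofSize]
    rw [this]
    exact Nat.le_add_right _ _
  obtain ⟨n, hn⟩ := exists_pow_lt_fastGrowing ψ.size (c + 1)
  refine ⟨ofSize _ hg, List.replicate n Alphabet.zero, ?_⟩
  -- Splitting off the innermost application leaves the same iterate of g on both sides, so only the
  -- arguments are compared.
  rw [iter_apply, length_ofSize_iterate, List.length_replicate, Function.iterate_succ_apply]
  exact (hc n).trans_lt (hg.iterate _ hn)

end Reg

/-! ### Halting and length of the output -/

namespace OracleTM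

variable {A : Type} (M : OracleTM A) (φ : List A → List A)

theorem next_of_halted {c : M.Cfg} (h : M.Halted c) : M.next φ c = c := by
  unfold next
  rw [show M.action c = Action.halt from h]

theorem iterate_next_of_halted {c : M.Cfg} {t t' : ℕ} (ht : t ≤ t')
    (h : M.Halted ((M.next φ)^[t] c)) : (M.next φ)^[t'] c = (M.next φ)^[t] c := by
  obtain ⟨s, rfl⟩ := Nat.exists_eq_add_of_le' ht
  rw [Function.iterate_add_apply]
  exact Function.iterate_fixed (M.next_of_halted φ h) s

theorem length_output_next_le (c : M.Cfg) :
    (M.next φ c).output.length ≤ c.output.length + 1 := by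
  unfold next
  split
  · exact Nat.le_succ _
  · exact Nat.le_succ _
  · next o _ => cases o <;> simp

theorem length_output_run_le (u : List A) (t : ℕ) : (M.run φ u t).output.length ≤ t := by
  induction t with
  | zero => exact le_rfl
  | succ t ih =>
    rw [run, Function.iterate_succ_apply']
    exact (M.length_output_next_le φ _).trans (Nat.succ_le_succ ih)

variable {M}

/-- A halted configuration no longer changes, so even if halting is witnessed after the time bound,
the output was already complete at the bound. -/
theorem RunsInTime.length_le [Alphabet A] {P : SOPoly} (hM : M.RunsInTime P) {φ : Reg A}
    {u v : List A} (h : M.Outputs φ u v) : v.length ≤ P.eval φ.size u.length := by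
  obtain ⟨t, ht, rfl⟩ := h
  have hP := hM φ u
  rcases le_total t (P.eval φ.size u.length) with h | h
  · exact (M.length_output_run_le _ _ _).trans h
  · rw [run, M.iterate_next_of_halted _ h hP]
    exact M.length_output_run_le _ _ _

end OracleTM

/-- If `P` witnesses polynomial-time computability of `F`, then no section `F(ψ, ·)` is the
`(deg P + 1)`-fold iteration. -/
theorem WitnessesPolyTime₂.not_exists_iter {A : Type} [Alphabet A] {P : SOPoly}
    {F : Reg A × Reg A →. Reg A} (h : WitnessesPolyTime₂ P F) :
    ¬ ∃ ψ : Reg A, ∀ φ : Reg A, Reg.iter (P.deg + 1) φ ∈ F (ψ, φ) := by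
  rintro ⟨ψ, hψ⟩
  obtain ⟨M, hF, hP⟩ := h
  obtain ⟨φ, u, hu⟩ := Reg.exists_eval_lt_length_iter P ψ
  exact hu.not_ge (hP.length_le (hF ψ φ _ (hψ φ) u))

/-! ### Finite transducers -/

/-- A finite transducer emitting at most one letter for each letter read. -/
structure Transducer (A : Type) where
  S : Type
  finiteS : Finite S
  start : S
  step : S → A → S × Option A

namespace Transducer

variable {A : Type}

/-- The output on a string, starting in state `s`. -/
def run (T : Transducer A) : T.S → List A → List A
  | _, [] => []
  | s, a :: w => (T.step s a).2.toList ++ run T (T.step s a).1 w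

/-- The output on a string, starting in the initial state. -/
def eval (T : Transducer A) (w : List A) : List A := T.run T.start w

/-- The transducer copying its input. -/
def id (A : Type) : Transducer A where
  S := Unit
  finiteS := inferInstance
  start := ()
  step _ a := ((), some a)

theorem eval_id (w : List A) : (id A).eval w = w := by
  change (id A).run () w = w
  induction w with
  | nil => rfl
  | cons a w ih => exact congrArg (a :: ·) ih

/-- The transducer applying first `T`, then `U`. -/
def comp (U T : Transducer A) : Transducer A where
  S := T.S × U.S
  finiteS := have := T.finiteS; have := U.finiteS; inferInstance
  start := (T.start, U.start)
  step s a :=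
    match (T.step s.1 a).2 with
    | none => (((T.step s.1 a).1, s.2), none)
    | some b => (((T.step s.1 a).1, (U.step s.2 b).1), (U.step s.2 b).2)

theorem run_comp (U T : Transducer A) (s : T.S) (s' : U.S) (w : List A) :
    (U.comp T).run (s, s') w = U.run s' (T.run s w) := by
  induction w generalizing s s' with
  | nil => rfl
  | cons a w ih =>
    simp only [run, comp]
    rcases h : (T.step s a).2 with _ | b
    · exact ih _ _
    · exact congrArg _ (ih _ _)

theorem eval_comp (U T : Transducer A) (w : List A) :
    (U.comp T).eval w = U.eval (T.eval w) := run_comp _ _ _ _ _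

/-- The parts of a string `⟨u, v⟩` at which a transducer can be. -/
inductive PairState where
  | padding
  | mark
  | letter
  | rest

instance : Finite PairState :=
  Finite.of_injective
    (fun s : PairState => match s with
      | .padding => (0 : Fin 4)
      | .mark => 1
      | .letter => 2
      | .rest => 3)
    (by rintro (_ | _ | _ | _) (_ | _ | _ | _) h <;> first | rfl | exact absurd h (by decide))

variable [Alphabet A]

open Classical in
/-- The transducer decoding `⟨u, v⟩`: it emits `u` if `left` is true and `v` otherwise. -/
noncomputable def proj (A : Type) [Alphabet A] (left : Bool) : Transducer A where
  S := PairState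
  finiteS := inferInstance
  start := .padding
  step
    | .padding, a => (if a = Alphabet.one then .mark else .padding, none)
    | .mark, a => (if a = Alphabet.one then .letter else .rest, none)
    | .letter, a => (.mark, if left then some a else none)
    | .rest, a => (.rest, if left then none else some a)

theorem run_proj_rest (left : Bool) (v : List A) :
    (proj A left).run PairState.rest v = if left then [] else v := by
  induction v with
  | nil => cases left <;> rfl
  | cons a v ih =>
    refine (congrArg _ ih).trans ?_
    cases left <;> rfl

theorem run_proj_markStr (left : Bool) (u v : List A) :
    (proj A left).run PairState.mark (markStr u v) = if left then u else v := by
  induction u with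
  | nil =>
    have h : ((proj A left).step PairState.mark Alphabet.zero).1 = PairState.rest :=
      if_neg Alphabet.zero_ne_one
    refine (congrArg (fun s => (proj A left).run s v) h).trans (run_proj_rest left v)
  | cons a u ih =>
    have h : ((proj A left).step PairState.mark Alphabet.one).1 = PairState.letter :=
      if_pos rfl
    refine (congrArg (fun s => (proj A left).run s (a :: markStr u v)) h).trans ?_
    refine (congrArg _ ih).trans ?_
    cases left <;> rfl

theorem eval_proj_pairStr (left : Bool) (u v : List A) :
    (proj A left).eval (pairStr u v) = if left then u else v := by
  have key : ∀ n, (proj A left).run PairState.padding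
      (List.replicate n Alphabet.zero ++ Alphabet.one :: markStr u v) = if left then u else v := by
    intro n
    induction n with
    | zero =>
      have h : ((proj A left).step PairState.padding Alphabet.one).1 = PairState.mark :=
        if_pos rfl
      exact (congrArg (fun s => (proj A left).run s (markStr u v)) h).trans
        (run_proj_markStr left u v)
    | succ n ih =>
      have h : ((proj A left).step PairState.padding Alphabet.zero).1 = PairState.padding :=
        if_neg Alphabet.zero_ne_one
      exact (congrArg (fun s => (proj A left).run s _) h).trans ih
  exact key _

end Transducer

/-! ### Iterating a transduced oracle -/

namespace OracleTM

variable {A : Type}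

/-- The tape contains the string `w` from the head on. -/
def Reads (T : Turing.Tape (Option A)) (w : List A) : Prop :=
  T.head = (w.map some).headI ∧ T.right = Turing.ListBlank.mk (w.map some).tail

theorem reads_stringTape (w : List A) : Reads (stringTape w) w := ⟨rfl, rfl⟩

theorem Reads.move {T : Turing.Tape (Option A)} {a : A} {w : List A} (h : Reads T (a :: w)) :
    Reads (T.move Turing.Dir.right) w := by
  obtain ⟨b, L, R⟩ := T
  obtain ⟨-, rfl : R = _⟩ := h
  exact ⟨rfl, rfl⟩

theorem next_of_step {M : OracleTM A} {φ : List A → List A} {c : M.Cfg} {q : M.Q}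
    {i j : Option Turing.Dir} {work : Fin M.k → M.G × Option Turing.Dir} {x y : Option A}
    (h : M.action c = Action.step q i j work x y) :
    M.next φ c =
      { state := q
        input := moveHead c.input i
        work := fun i => moveHead ((c.work i).write (work i).1) (work i).2
        query := c.query ++ x.toList
        answer := moveHead c.answer j
        output := c.output ++ y.toList } := by
  unfold next; rw [h]

theorem next_of_query {M : OracleTM A} {φ : List A → List A} {c : M.Cfg} {q : M.Q}
    (h : M.action c = Action.query q) :
    M.next φ c =
      { c with state := q, query := [], answer := stringTape (φ c.query) } := by
  unfold next; rw [h]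

/-- From the configuration `c`, the machine halts with output `v` within `t` steps. -/
def HaltsFrom (M : OracleTM A) (φ : List A → List A) (c : M.Cfg) (t : ℕ) (v : List A) : Prop :=
  ∃ s ≤ t, M.Halted ((M.next φ)^[s] c) ∧ ((M.next φ)^[s] c).output = v

theorem HaltsFrom.of_next {M : OracleTM A} {φ : List A → List A} {c c' : M.Cfg} {t : ℕ}
    {v : List A} (hc : M.next φ c = c') (h : M.HaltsFrom φ c' t v) :
    M.HaltsFrom φ c (t + 1) v := by
  obtain ⟨s, hs, h⟩ := h
  exact ⟨s + 1, Nat.succ_le_succ hs, by rwa [Function.iterate_succ_apply, hc]⟩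

theorem HaltsFrom.mono {M : OracleTM A} {φ : List A → List A} {c : M.Cfg} {t t' : ℕ}
    {v : List A} (h : M.HaltsFrom φ c t v) (ht : t ≤ t') : M.HaltsFrom φ c t' v := by
  obtain ⟨s, hs, h⟩ := h
  exact ⟨s, hs.trans ht, h⟩

theorem HaltsFrom.congr_output {M : OracleTM A} {φ : List A → List A} {c : M.Cfg} {t : ℕ}
    {v v' : List A} (h : M.HaltsFrom φ c t v) (hv : v = v') : M.HaltsFrom φ c t v' :=
  hv ▸ h

end OracleTM

namespace Transducer

open OracleTM

variable {A : Type} (T : Transducer A) (n : ℕ)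

/-- The machine that computes, on oracle `φ`, the `(n + 1)`-fold iterate of `T ∘ φ`. In state
`some (i, s)` it applies `T` to the answer tape, with `i` oracle queries to go. -/
def iterTM : OracleTM A where
  Q := Option (Fin (n + 1) × T.S)
  finiteQ := have := T.finiteS; inferInstance
  start := none
  G := Unit
  finiteG := inferInstance
  blank := inferInstance
  k := 0
  trans
    | none, some a, _, _ => .step none (some .right) none (fun _ => ((), none)) (some a) none
    | none, none, _, _ => .query (some (Fin.last n, T.start))
    | some (⟨0, hi⟩, s), _, some a, _ =>
      .step (some (⟨0, hi⟩, (T.step s a).1)) none (some .right) (fun _ => ((), none)) none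
        (T.step s a).2
    | some (⟨0, _⟩, _), _, none, _ => .halt
    | some (⟨i + 1, hi⟩, s), _, some a, _ =>
      .step (some (⟨i + 1, hi⟩, (T.step s a).1)) none (some .right) (fun _ => ((), none))
        (T.step s a).2 none
    | some (⟨i + 1, hi⟩, _), _, none, _ => .query (some (⟨i, by omega⟩, T.start))

/-- The time needed by `Transducer.iterTM` for `i` queries, the first one of length at most `X`. -/
def queryTime : ℕ → SOPoly → SOPoly
  | 0, _ => .const 1
  | i + 1, X => .add (.add (.app X) (.const 1)) (queryTime i (.app X))

/-- Allows the cost of the remaining queries, measured from the actual length of an answer, to be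
compared with the cost measured from the preceding query. -/
theorem eval_queryTime_mono {L : ℕ → ℕ} (hL : Monotone L) (i : ℕ) {X Y : SOPoly} {m k : ℕ}
    (h : X.eval L m ≤ Y.eval L k) : (queryTime i X).eval L m ≤ (queryTime i Y).eval L k := by
  induction i generalizing X Y with
  | zero => exact le_rfl
  | succ i ih => exact add_le_add (add_le_add (hL h) le_rfl) (ih (hL h))

variable [Alphabet A]

/-- The outer induction is on the queries left, the inner one on the unread part of the answer. The
invariant is that the query tape followed by `T.run s w` is the next query, of length at most
`c.query.length + w.length`. With no queries left, T writes to the output instead, whence the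
condition `hq`. -/
theorem haltsFrom_iterTM_scan (φ : Reg A) (i : ℕ) (hi : i < n + 1) (s : T.S) (w : List A)
    (c : (T.iterTM n).Cfg) (hs : c.state = some (⟨i, hi⟩, s)) (hw : Reads c.answer w)
    (hq : i = 0 → c.query = []) :
    (T.iterTM n).HaltsFrom φ c
      (w.length + (queryTime i .var).eval φ.size (c.query.length + w.length))
      (c.output ++ (fun x => T.eval (φ x))^[i] (c.query ++ T.run s w)) := by
  induction i generalizing s w c with
  | zero =>
    induction w generalizing s c with
    | nil =>
      have hact : (T.iterTM n).action c = Action.halt := by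
        have h := hw.1
        simp only [List.map_nil] at h
        rw [action, hs, h]; rfl
      exact ⟨0, Nat.zero_le _, hact, by simp [hq rfl, run]⟩
    | cons a w ih =>
      have hact : (T.iterTM n).action c = .step (some (⟨0, hi⟩, (T.step s a).1)) none
          (some .right) (fun _ => ((), none)) none (T.step s a).2 := by
        rw [action, hs, hw.1]; rfl
      refine ((HaltsFrom.of_next (next_of_step hact)
        (ih (T.step s a).1 _ rfl hw.move (by intro _; simpa using hq rfl))).mono ?_).congr_output ?_
      · simp [queryTime, SOPoly.eval]
      · simp [hq rfl, run]
  | succ i ih =>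
    clear hq
    induction w generalizing s c with
    | nil =>
      have hact : (T.iterTM n).action c = .query (some (⟨i, by omega⟩, T.start)) := by
        have h := hw.1
        simp only [List.map_nil] at h
        rw [action, hs, h]; rfl
      refine ((HaltsFrom.of_next (next_of_query hact)
        (ih (by omega) T.start (φ c.query) _ rfl (reads_stringTape _) fun _ => rfl)).mono
          ?_).congr_output ?_
      · have hm := eval_queryTime_mono φ.monotone_size i (X := .var) (Y := .app .var)
          (m := 0 + (φ c.query).length) (k := c.query.length)
          (by simp [SOPoly.eval, φ.size_length])
        simp only [queryTime, SOPoly.eval, List.length_nil, PNat.val_ofNat] at hm ⊢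
        simp only [Nat.add_zero, φ.size_length] at hm ⊢
        omega
      · simp [run, eval]
    | cons a w ihw =>
      have hact : (T.iterTM n).action c = .step (some (⟨i + 1, hi⟩, (T.step s a).1)) none
          (some .right) (fun _ => ((), none)) (T.step s a).2 none := by
        rw [action, hs, hw.1]; rfl
      refine ((HaltsFrom.of_next (next_of_step hact)
        (ihw (T.step s a).1 _ rfl hw.move)).mono ?_).congr_output ?_
      · have hl : (T.step s a).2.toList.length ≤ 1 := by cases (T.step s a).2 <;> simp
        have hm := eval_queryTime_mono φ.monotone_size (i + 1) (X := .var) (Y := .var)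
          (m := (c.query ++ (T.step s a).2.toList).length + w.length)
          (k := c.query.length + (a :: w).length)
          (by simp only [SOPoly.eval, List.length_append, List.length_cons]; omega)
        simp only [List.length_cons] at hm ⊢
        omega
      · simp [run]

/-- T acts on answers only: the first query is the unchanged input, and all n + 1 queries are still
to come. -/
theorem haltsFrom_iterTM_copy (φ : Reg A) (w : List A) (c : (T.iterTM n).Cfg)
    (hs : c.state = none) (hw : Reads c.input w) (ha : c.answer = stringTape []) :
    (T.iterTM n).HaltsFrom φ c
      (w.length + (queryTime (n + 1) .var).eval φ.size (c.query ++ w).length)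
      (c.output ++ (fun x => T.eval (φ x))^[n + 1] (c.query ++ w)) := by
  induction w generalizing c with
  | nil =>
    have hact : (T.iterTM n).action c = .query (some (Fin.last n, T.start)) := by
      have h := hw.1
      simp only [List.map_nil] at h
      rw [action, hs, h]; rfl
    refine ((HaltsFrom.of_next (next_of_query hact)
      (T.haltsFrom_iterTM_scan n φ n (by omega) T.start (φ c.query) _ rfl
        (reads_stringTape _) fun _ => rfl)).mono ?_).congr_output ?_
    · have hm := eval_queryTime_mono φ.monotone_size n (X := .var) (Y := .app .var)
        (m := 0 + (φ c.query).length) (k := c.query.length)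
        (by simp [SOPoly.eval, φ.size_length])
      simp only [queryTime, SOPoly.eval, List.length_nil, List.append_nil, φ.size_length,
        PNat.val_ofNat] at hm ⊢
      omega
    · simp [eval]
  | cons a w ih =>
    have hact : (T.iterTM n).action c = .step none (some .right) none (fun _ => ((), none))
        (some a) none := by
      rw [action, hs, hw.1]; rfl
    refine ((HaltsFrom.of_next (next_of_step hact)
      (ih _ rfl hw.move ha)).mono ?_).congr_output ?_
    · simp only [List.length_append, List.length_cons, Option.toList_some,
        List.append_assoc, List.cons_append, List.nil_append]
      omega
    · simp

/-- The running time of `Transducer.iterTM`. -/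
def iterTime (n : ℕ) : SOPoly := .add .var (queryTime (n + 1) .var)

theorem haltsFrom_iterTM_init (φ : Reg A) (u : List A) :
    (T.iterTM n).HaltsFrom φ ((T.iterTM n).init u) ((iterTime n).eval φ.size u.length)
      ((fun x => T.eval (φ x))^[n + 1] u) :=
  T.haltsFrom_iterTM_copy n φ u _ rfl (reads_stringTape u) rfl

theorem runsInTime_iterTM : (T.iterTM n).RunsInTime (iterTime n) := by
  intro φ u
  obtain ⟨s, hs, h, -⟩ := T.haltsFrom_iterTM_init n φ u
  rw [OracleTM.run, iterate_next_of_halted _ _ hs h]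
  exact h

/-- A functional that is given by iterating an oracle, transduced by a finite transducer, is
computable in polynomial time. -/
theorem polyTimeComputable {F : Reg A →. Reg A}
    (hF : ∀ φ, ∀ χ ∈ F φ, ∀ u, (fun x => T.eval (φ x))^[n + 1] u = χ u) :
    PolyTimeComputable F := by
  refine ⟨T.iterTM n, iterTime n, fun φ χ hχ u => ?_, T.runsInTime_iterTM n⟩
  obtain ⟨s, -, h, h'⟩ := T.haltsFrom_iterTM_init n φ u
  exact ⟨s, h, h'.trans (hF φ χ hχ u)⟩

end Transducer

/-! ### Basic morphisms and points of products -/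

namespace RepSpace

variable {A : Type}

theorem mem_rep_reg {φ ψ : Reg A} : ψ ∈ (reg A).rep φ ↔ ψ = φ := Part.mem_some_iff

variable [Alphabet A]

/-- A map is computable in polynomial time if it is realized by iterating the name, transduced by
a finite transducer. -/
theorem isPolyTime_of_transducer {X Y : RepSpace A} (f : X → Y) (T : Transducer A) (n : ℕ)
    (h : ∀ (φ : Reg A) (x : X), x ∈ X.rep φ →
      ∃ χ : Reg A, f x ∈ Y.rep χ ∧ ∀ u, (fun x => T.eval (φ x))^[n + 1] u = χ u) :
    IsPolyTime f := by
  -- The iterate need not be regular for every φ, so the realizer is defined exactly where it is.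
  refine ⟨fun φ => ⟨∃ χ : Reg A, ∀ u, (fun x => T.eval (φ x))^[n + 1] u = χ u,
    fun h => h.choose⟩, T.polyTimeComputable n ?_, ?_⟩
  · rintro φ _ ⟨h, rfl⟩
    exact h.choose_spec
  · intro φ x hx
    obtain ⟨χ, hY, hχ⟩ := h φ x hx
    have hd : ∃ χ : Reg A, ∀ u, (fun x => T.eval (φ x))^[n + 1] u = χ u := ⟨χ, hχ⟩
    have he : hd.choose = χ := Reg.ext (funext fun u => (hd.choose_spec u).symm.trans (hχ u))
    exact ⟨χ, ⟨hd, he⟩, hY⟩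

theorem isPolyTime_of_eval {X Y : RepSpace A} (f : X → Y) (T : Transducer A)
    (h : ∀ (φ : Reg A) (x : X), x ∈ X.rep φ →
      ∃ χ : Reg A, f x ∈ Y.rep χ ∧ ∀ u, T.eval (φ u) = χ u) :
    IsPolyTime f :=
  isPolyTime_of_transducer f T 0 h

theorem isPolyTime_id (X : RepSpace A) : IsPolyTime (fun x : X => x) :=
  isPolyTime_of_eval _ (.id A) fun φ _ hx => ⟨φ, hx, fun _ => Transducer.eval_id _⟩

theorem isPolyTime_fst (X Y : RepSpace A) :
    IsPolyTime (X := X.prod Y) (Y := X) (fun z => z.1) := by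
  refine isPolyTime_of_eval _ (.proj A true) fun χ z hz => ?_
  obtain ⟨φ, ψ, rfl, hφ, -⟩ := (mem_prodRep X Y χ z).1 hz
  exact ⟨φ, hφ, fun u => Transducer.eval_proj_pairStr true _ _⟩

theorem isPolyTime_snd (X Y : RepSpace A) :
    IsPolyTime (X := X.prod Y) (Y := Y) (fun z => z.2) := by
  refine isPolyTime_of_eval _ (.proj A false) fun χ z hz => ?_
  obtain ⟨φ, ψ, rfl, -, hψ⟩ := (mem_prodRep X Y χ z).1 hz
  exact ⟨ψ, hψ, fun u => Transducer.eval_proj_pairStr false _ _⟩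

theorem isPolyTime_iter (n : ℕ) :
    IsPolyTime (X := reg A) (Y := reg A) (Reg.iter (n + 1)) := by
  refine isPolyTime_of_transducer _ (.id A) n fun φ x hx => ?_
  obtain rfl := mem_rep_reg.1 hx
  refine ⟨_, mem_rep_reg.2 rfl, fun u => ?_⟩
  simp only [Transducer.eval_id]
  exact (Reg.iter_apply _ _ _).symm

theorem isPolyTime_iter_snd (X : RepSpace A) (n : ℕ) :
    IsPolyTime (X := X.prod (reg A)) (Y := reg A) (fun z => Reg.iter (n + 1) z.2) := by
  refine isPolyTime_of_transducer _ (.proj A false) n fun χ z hz => ?_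
  obtain ⟨φ, ψ, rfl, -, hψ⟩ := (mem_prodRep X _ χ z).1 hz
  obtain hψ := mem_rep_reg.1 hψ
  refine ⟨_, mem_rep_reg.2 rfl, fun u => ?_⟩
  have : (fun x => (Transducer.proj A false).eval (Reg.pair φ ψ x)) = ψ.toFun :=
    funext fun x => Transducer.eval_proj_pairStr false _ _
  rw [this, ← hψ]
  exact (Reg.iter_apply _ _ _).symm

/-- The one-point space in which every regular function is a name of the point. -/
def unit (A : Type) : RepSpace A where
  carrier := Unit
  rep _ := Part.some ()
  surj _ := ⟨⟨fun u => u, fun _ _ h => h, fun _ _ h => h⟩, Part.mem_some _⟩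

/-- The one-point space whose point has the only name `ζ`. -/
def singleton (ζ : Reg A) : RepSpace A where
  carrier := Unit
  rep φ := ⟨φ = ζ, fun _ => ()⟩
  surj _ := ⟨ζ, rfl, rfl⟩

theorem isPolyTime_unit {X : RepSpace A} (f : X → unit A) : IsPolyTime f :=
  isPolyTime_of_eval _ (.id A) fun φ _ _ => ⟨φ, Part.mem_some _, fun _ => Transducer.eval_id _⟩

/-- The name ζ is supplied as oracle, so a point without any computable name can still be the value
of a morphism. -/
theorem isPolyTime_singleton {X : RepSpace A} {ζ χ : Reg A} {x : X} (hx : x ∈ X.rep χ)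
    (T : Transducer A) (hT : ∀ u, T.eval (ζ u) = χ u) :
    IsPolyTime (X := singleton ζ) (fun _ => x) := by
  refine isPolyTime_of_eval _ T fun φ _ hφ => ⟨χ, hx, ?_⟩
  obtain ⟨rfl : φ = ζ, -⟩ := hφ
  exact hT

/-- `X` is a product of the one-point space and `X`. -/
theorem isProduct_unit (X : RepSpace A) :
    IsProduct (unit A) X X (fun _ => ()) (fun x => x) :=
  ⟨isPolyTime_unit _, isPolyTime_id X, fun _ _ g _ hg =>
    ⟨g, ⟨hg, funext fun _ => rfl, rfl⟩, fun _ h => h.2.2⟩⟩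

/-- A point of a product is determined by its projections. -/
theorem IsProduct.ext {X Y W : RepSpace A} {p : W → X} {q : W → Y} (hW : IsProduct X Y W p q)
    {w w' : W} (hp : p w = p w') (hq : q w = q w') : w = w' := by
  obtain ⟨ω, hω⟩ := W.surj w
  obtain ⟨ω', hω'⟩ := W.surj w'
  obtain ⟨ξ, hξ⟩ := X.surj (p w)
  obtain ⟨η, hη⟩ := Y.surj (q w)
  -- One oracle packs names of both points and of their common projections; i selects the outer
  -- component and j the inner one.
  have key : ∀ (i j : Bool) (u : List A),
      ((Transducer.proj A j).comp (.proj A i)).eval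
        (Reg.pair (Reg.pair ω ω') (Reg.pair ξ η) u) =
      if i then (if j then ω u else ω' u) else (if j then ξ u else η u) := by
    intro i j u
    rw [Transducer.eval_comp]
    refine (congrArg _ (Transducer.eval_proj_pairStr i _ _)).trans ?_
    cases i <;> exact Transducer.eval_proj_pairStr j _ _
  obtain ⟨h, -, hu⟩ := hW.2.2 (singleton (Reg.pair (Reg.pair ω ω') (Reg.pair ξ η)))
    (fun _ => p w) (fun _ => q w) (isPolyTime_singleton hξ _ (key false true))
    (isPolyTime_singleton hη _ (key false false))
  -- Both constant maps are mediating morphisms for the same cone, so uniqueness identifies them.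
  have h1 := hu (fun _ => w) ⟨isPolyTime_singleton hω _ (key true true), rfl, rfl⟩
  have h2 := hu (fun _ => w') ⟨isPolyTime_singleton hω' _ (key true false),
    funext fun _ => hp.symm, funext fun _ => hq.symm⟩
  exact congrFun (h1.trans h2.symm) ()

/-! ### Nonexistence of exponentials -/

/-- There is no exponential of `Reg` by `Reg` with respect to the standard products. -/
theorem not_isExponential_reg (E : RepSpace A) (ev : E.prod (reg A) → reg A) :
    ¬ IsExponential (reg A) (reg A) E ev := by
  rintro ⟨⟨F, ⟨M, P, hM, hP⟩, hF⟩, hE⟩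
  obtain ⟨g, ⟨-, hg⟩, -⟩ := hE (unit A) _ (isPolyTime_iter_snd (unit A) P.deg)
  obtain ⟨ψ, hψ⟩ := E.surj (g ())
  obtain ⟨φ, u, hu⟩ := Reg.exists_eval_lt_length_iter P ψ
  obtain ⟨χ, hχ, hev⟩ := hF (Reg.pair ψ φ) (g (), φ)
    ((mem_prodRep E (reg A) _ _).2 ⟨ψ, φ, rfl, hψ, mem_rep_reg.2 rfl⟩)
  have h : Reg.iter (P.deg + 1) φ = χ := (hg () φ).symm.trans (mem_rep_reg.1 hev)
  rw [h] at hu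
  exact hu.not_ge (hP.length_le (hM _ χ hχ u))

/-- There is no exponential of `Reg` by `Reg` with respect to arbitrary categorical products. -/
theorem not_hasExponential_reg : ¬ HasExponential (reg A) (reg A) := by
  rintro ⟨E, W, p, q, ev, hW, ⟨F, ⟨M, P, hM, hP⟩, hF⟩, hE⟩
  -- The comparison map k from the standard product makes names of points of W accessible from pairs
  -- of names, with size bounded by R.
  obtain ⟨k, ⟨⟨K, ⟨N, R, hN, hR⟩, hK⟩, hpk, hqk⟩, -⟩ :=
    hW.2.2 (E.prod (reg A)) _ _ (isPolyTime_fst E (reg A)) (isPolyTime_snd E (reg A))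
  -- Take Z to be the one-point space and Reg itself as its product with Reg.
  obtain ⟨g, ⟨-, h, -, hph, hqh, hev⟩, -⟩ :=
    hE _ _ _ _ (isProduct_unit (reg A)) _ (isPolyTime_iter (SOPoly.comp R P).deg)
  obtain ⟨ψ, hψ⟩ := E.surj (g ())
  obtain ⟨φ, u, hu⟩ := Reg.exists_eval_lt_length_iter (SOPoly.comp R P) ψ
  have hk : k (g (), φ) = h φ :=
    hW.ext ((congrFun hpk (g (), φ)).trans (congrFun hph φ).symm)
      ((congrFun hqk (g (), φ)).trans (congrFun hqh φ).symm)
  obtain ⟨κ, hκ, hkκ⟩ := hK (Reg.pair ψ φ) (g (), φ)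
    ((mem_prodRep E (reg A) _ _).2 ⟨ψ, φ, rfl, hψ, mem_rep_reg.2 rfl⟩)
  obtain ⟨χ, hχ, hevχ⟩ := hF κ _ hkκ
  have hiter : Reg.iter ((SOPoly.comp R P).deg + 1) φ = χ := by
    rw [hk] at hevχ
    exact (congrFun hev φ).symm.trans (mem_rep_reg.1 hevχ)
  rw [hiter, SOPoly.eval_comp] at hu
  refine hu.not_ge ((hP.length_le (hM _ χ hχ u)).trans ?_)
  -- The oracle given to M is κ, whose size is at most the value of R at the size of ⟨ψ, φ⟩.
  refine SOPoly.eval_mono (fun m => ?_) (fun m m' hm => ?_) le_rfl P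
  · simpa [Reg.size] using
      hR.length_le (hN _ κ hκ (List.replicate m Alphabet.zero))
  · exact SOPoly.eval_mono (fun _ => le_rfl) (Reg.monotone_size _) hm R

end RepSpace

end PolyRep

theorem mainTheorem1 {A : Type} [PolyRep.Alphabet A] :
    (∀ (P : PolyRep.SOPoly) (F : PolyRep.Reg A × PolyRep.Reg A →. PolyRep.Reg A),
      PolyRep.WitnessesPolyTime₂ P F →
        ¬ ∃ ψ : PolyRep.Reg A, ∀ φ : PolyRep.Reg A,
          PolyRep.Reg.iter (P.deg + 1) φ ∈ F (ψ, φ)) ∧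
    (¬ ∃ (E : PolyRep.RepSpace A)
        (ev : E.prod (PolyRep.RepSpace.reg A) → PolyRep.RepSpace.reg A),
      PolyRep.RepSpace.IsExponential (PolyRep.RepSpace.reg A) (PolyRep.RepSpace.reg A) E ev) ∧
    ¬ PolyRep.RepSpace.HasExponential (PolyRep.RepSpace.reg A) (PolyRep.RepSpace.reg A) ∧
    ¬ PolyRep.RepSpace.IsCartesianClosed A :=
  ⟨fun _ _ h => h.not_exists_iter,
    fun ⟨E, ev, h⟩ => PolyRep.RepSpace.not_isExponential_reg E ev h,
    PolyRep.RepSpace.not_hasExponential_reg,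
    fun h => PolyRep.RepSpace.not_hasExponential_reg (h.2.2 _ _)⟩
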